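/- Let $A,E,Q\in\mathbb{C}^{n\times n}$ with $Q$ nonsingular and $Q^{-1}AQ=\operatorname{diag}(J_1,\dots,J_p)$, where each $J_i\in\mathbb{C}^{m_i\times m_i}$ ($m_i\ge 1$, $\sum_{i=1}^p m_i=n$) is an (upper) Jordan block. Put $\widetilde A=A+E$, $E_Q=Q^{-1}EQ$, $m=\max_i m_i$, and let $\{\lambda_i\}_{i=1}^n$, $\{\widetilde\lambda_i\}_{i=1}^n$ be the eigenvalues of $A$ and $\widetilde A$, listed with algebraic multiplicity. For $M\in\mathbb{C}^{n\times n}$ let $\delta(M)=\big(\|M\|_F^2-\tfrac1n|\operatorname{tr}M|^2\big)^{1/2}$ and let $s(M)$ be the largest $s$ for which there is a unitary $U$ with $U^*MU=\operatorname{diag}(M_1,\dots,M_s)$, each $M_i$ being a square block of order at least $1$. Let $\varepsilon=\|E_Q\|_F^{1/m}$, $T=\operatorname{diag}(T_1,\dots,T_p)$ with $T_i=\operatorname{diag}(1,\varepsilon,\dots,\varepsilon^{m_i-1})$, and $$s_1=n+1-s(T^{-1}Q^{-1}\widetilde AQT)\ \ (E\neq0),\qquad s_2=n+1-s(Q^{-1}\widetilde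 AQ).$$ For real $c$ write $$B_1(c)=\sqrt{c\Big(n-p+2\sqrt{n-p}\,\delta(E_Q)+\tfrac{\delta(E_Q)^2}{\|E_Q\|_F^2}\Big)\|E_Q\|_F^{2/m}+\tfrac1n|\operatorname{tr}E|^2}\ \ (E\neq0),$$ $$B_2(c)=\sqrt{c\big(\sqrt{n-p}+\delta(E_Q)\big)^2+\tfrac1n|\operatorname{tr}E|^2}.$$ Then there is a permutation $\pi$ of $\{1,\dots,n\}$ such that $\mathbb{D}_2=\big(\sum_{i=1}^n|\widetilde\lambda_{\pi(i)}-\lambda_i|^2\big)^{1/2}$ satisfies $$\mathbb{D}_2\le B_1(s_1)\ \text{ if } 0<\|E_Q\|_F<1,\qquad \mathbb{D}_2\le B_2(s_2)\ \text{ if } \|E_Q\|_F\ge1,$$ and $\mathbb{D}_2=0$ if $E=0$. Moreover, these bounds are at most the same bounds with factor $n$ and at most the bounds of Li and Chen: if $0<\|E_Q\|_F<1$, then $$B_1(s_1)\le B_1(n)\quad\text{and}\quad B_1(s_1)\le\sqrt{s_1\big(n-p+1+2\sqrt{n-p}\,\|E_Q\|_F\big)}\;\|E_Q\|_F^{1/m};$$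 if $\|E_Q\|_F\ge1$, then $$B_2(s_2)\le B_2(n)\quad\text{and}\quad B_2(s_2)\le\sqrt{s_2\big(n-p+2\sqrt{n-p}+\|E_Q\|_F\big)}\;\|E_Q\|_F^{1/2}.$$ -/

import Mathlib

open scoped Matrix.Norms.Frobenius

namespace SpectrumVariation

noncomputable section

/-- `diag(B₁, …, Bₚ)`: the `n × n` matrix with square diagonal blocks `Bᵢ` of order `k i`,
placed consecutively in this order (`finSigmaFinEquiv` is the lexicographic enumeration). -/
def blockDiag {n p : ℕ} (k : Fin p → ℕ) (hk : ∑ i, k i = n)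
    (B : ∀ i, Matrix (Fin (k i)) (Fin (k i)) ℂ) : Matrix (Fin n) (Fin n) ℂ :=
  Matrix.reindex (finSigmaFinEquiv.trans (finCongr hk)) (finSigmaFinEquiv.trans (finCongr hk))
    (Matrix.blockDiagonal' B)

/-- The upper Jordan block of order `m` with eigenvalue `μ`. -/
def jordanBlock (m : ℕ) (μ : ℂ) : Matrix (Fin m) (Fin m) ℂ :=
  Matrix.of fun i j => if i = j then μ else if (i : ℕ) + 1 = (j : ℕ) then 1 else 0

/-- `T = diag(T₁, …, Tₚ)` with `Tᵢ = diag(1, ε, …, ε ^ (k i - 1))`. -/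
def scalingMatrix {n p : ℕ} (k : Fin p → ℕ) (hk : ∑ i, k i = n) (ε : ℝ) :
    Matrix (Fin n) (Fin n) ℂ :=
  blockDiag k hk fun i => Matrix.diagonal fun j : Fin (k i) => (ε : ℂ) ^ (j : ℕ)

/-- `δ(M) = (‖M‖_F² - |tr M|² / n)^(1/2)`. -/
def delta {n : ℕ} (M : Matrix (Fin n) (Fin n) ℂ) : ℝ :=
  Real.sqrt (‖M‖ ^ 2 - 1 / (n : ℝ) * ‖M.trace‖ ^ 2)

/-- The numbers `s` for which `M` is unitarily similar to a block-diagonal matrix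
`diag(M₁, …, Mₛ)` with `s` square diagonal blocks, each of order at least one. -/
def blockCounts {n : ℕ} (M : Matrix (Fin n) (Fin n) ℂ) : Set ℕ :=
  {s | ∃ U ∈ Matrix.unitaryGroup (Fin n) ℂ, ∃ (k : Fin s → ℕ) (hk : ∑ i, k i = n)
      (B : ∀ i, Matrix (Fin (k i)) (Fin (k i)) ℂ),
      (∀ i, 0 < k i) ∧ U.conjTranspose * M * U = blockDiag k hk B}

/-- `s(M)`, the largest element of `blockCounts M`. -/
def maxBlocks {n : ℕ} (M : Matrix (Fin n) (Fin n) ℂ) : ℕ :=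
  sSup (blockCounts M)

theorem le_of_mem_blockCounts {n : ℕ} {M : Matrix (Fin n) (Fin n) ℂ} {s : ℕ}
    (hs : s ∈ blockCounts M) : s ≤ n := by
  obtain ⟨U, -, k, hk, B, hpos, -⟩ := hs
  calc s = ∑ _i : Fin s, 1 := by simp
    _ ≤ ∑ i, k i := Finset.sum_le_sum fun i _ => hpos i
    _ = n := hk

theorem blockCounts_nonempty {n : ℕ} (M : Matrix (Fin n) (Fin n) ℂ) :
    (blockCounts M).Nonempty := by
  rcases Nat.eq_zero_or_pos n with rfl | hn
  · exact ⟨0, 1, one_mem _, Fin.elim0, by simp, fun i => i.elim0, fun i => i.elim0,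
      by ext i; exact i.elim0⟩
  · have hk : ∑ _i : Fin 1, n = n := by simp
    let e := (finSigmaFinEquiv (n := fun _ : Fin 1 => n)).trans (finCongr hk)
    refine ⟨1, 1, one_mem _, fun _ => n, hk,
      fun i => Matrix.of fun a b => M (e ⟨i, a⟩) (e ⟨i, b⟩), fun _ => hn, ?_⟩
    ext i j
    obtain ⟨⟨x, a⟩, rfl⟩ := e.surjective i
    obtain ⟨⟨y, b⟩, rfl⟩ := e.surjective j
    obtain rfl : x = y := Subsingleton.elim _ _
    simp only [Matrix.conjTranspose_one, one_mul, mul_one, blockDiag]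
    change _ = (Matrix.reindex e e _) _ _
    simp

/-- The maximum in the definition of `s(M)` is attained. -/
theorem isGreatest_maxBlocks {n : ℕ} (M : Matrix (Fin n) (Fin n) ℂ) :
    IsGreatest (blockCounts M) (maxBlocks M) :=
  have hb : BddAbove (blockCounts M) := ⟨n, fun _ h => le_of_mem_blockCounts h⟩
  ⟨Nat.sSup_mem (blockCounts_nonempty M) hb, fun _ h => le_csSup hb h⟩

/-- `lam` lists the eigenvalues of `M` with their algebraic multiplicities. -/
def IsSpectrum {n : ℕ} (M : Matrix (Fin n) (Fin n) ℂ) (lam : Fin n → ℂ) : Prop :=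
  M.charpoly.roots = Finset.univ.val.map lam

/-- `𝔻₂ = (∑ᵢ |lam' (π i) - lam i|²)^(1/2)`. -/
def spectralDist {n : ℕ} (lam lam' : Fin n → ℂ) (π : Equiv.Perm (Fin n)) : ℝ :=
  Real.sqrt (∑ i, ‖lam' (π i) - lam i‖ ^ 2)

/-- The bound in the case `‖F‖_F < 1` (`F = Q⁻¹EQ`, `F ≠ 0`) with leading factor `c`; `p` is the
number of Jordan blocks, `m` their maximal order. -/
def boundSmall {n : ℕ} (p m : ℕ) (c : ℝ) (E F : Matrix (Fin n) (Fin n) ℂ) : ℝ :=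
  Real.sqrt (c * ((n : ℝ) - p + 2 * Real.sqrt ((n : ℝ) - p) * delta F
      + delta F ^ 2 / ‖F‖ ^ 2) * ‖F‖ ^ (2 / (m : ℝ)) + 1 / (n : ℝ) * ‖E.trace‖ ^ 2)

/-- The bound in the case `1 ≤ ‖F‖_F` with leading factor `c`. -/
def boundLarge {n : ℕ} (p : ℕ) (c : ℝ) (E F : Matrix (Fin n) (Fin n) ℂ) : ℝ :=
  Real.sqrt (c * (Real.sqrt ((n : ℝ) - p) + delta F) ^ 2 + 1 / (n : ℝ) * ‖E.trace‖ ^ 2)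

/-- The Li–Chen bound in the case `‖F‖_F < 1` with leading factor `c`. -/
def liChenSmall {n : ℕ} (p m : ℕ) (c : ℝ) (F : Matrix (Fin n) (Fin n) ℂ) : ℝ :=
  Real.sqrt (c * ((n : ℝ) - p + 1 + 2 * Real.sqrt ((n : ℝ) - p) * ‖F‖)) * ‖F‖ ^ (1 / (m : ℝ))

/-- The Li–Chen bound in the case `1 ≤ ‖F‖_F` with leading factor `c`. -/
def liChenLarge {n : ℕ} (p : ℕ) (c : ℝ) (F : Matrix (Fin n) (Fin n) ℂ) : ℝ :=
  Real.sqrt (c * ((n : ℝ) - p + 2 * Real.sqrt ((n : ℝ) - p) + ‖F‖)) * ‖F‖ ^ (1 / 2 : ℝ)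

end

end SpectrumVariation

namespace SpectrumVariation

open Matrix

/-! After conjugation by `Q`, the perturbed matrix is `D + F`, with `D` diagonal and `F = N + E_Q`,
where `N` is the nilpotent part of the Jordan form. Block-diagonalise `D + F` unitarily into `s`
blocks and triangularise each block by Schur. With `V` the resulting unitary and `t = tr F`, put `X
= Vᴴ D V`, which is normal, and `Y = Vᴴ F V - (t/n) I`, which has norm `δ(F)`. Then `X + Y` is block
diagonal with upper triangular blocks of order at most `K = n + 1 - s`.

Normality forces the squared entries of `X` to have equal row and column sums, so they form a
balanced flow. Flow up within a block must return through entries where `X = -Y`. This gives `‖X -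
diag(X + Y)‖² ≤ K ‖Y‖²` (`sum_upper_le_of_balanced`, `norm_sub_diagonal_sq_le`). Hoffman–Wielandt,
via Birkhoff's theorem (`exists_perm_sum_le_norm_sq`), turns this into a matching of eigenvalues.
Undoing the shift by the mean adds exactly `|t|²/n` (`exists_perm_sum_sq_le`).

It remains to estimate `δ(F)`. For `‖E_Q‖ ≥ 1` the triangle inequality suffices. For `‖E_Q‖ < 1`,
conjugation by `T` shrinks `N` to `εN` while `E_Q` grows by at most `ε^(1-m)`
(`delta_scaled_sq_le`); the choice `ε^m = ‖E_Q‖` balances the two. -/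

/-! ### Frobenius norm and unitary invariance. -/

theorem frobenius_norm_sq {α β : Type*} [Fintype α] [Fintype β] (M : Matrix α β ℂ) :
    ‖M‖ ^ 2 = ∑ i, ∑ j, ‖M i j‖ ^ 2 := by
  rw [frobenius_norm_def, ← Real.sqrt_eq_rpow, Real.sq_sqrt (by positivity)]
  simp

theorem trace_conjTranspose_mul_self_eq {n : ℕ} (M : Matrix (Fin n) (Fin n) ℂ) :
    (Mᴴ * M).trace = ((‖M‖ ^ 2 : ℝ) : ℂ) := by
  rw [frobenius_norm_sq, Finset.sum_comm]
  simp only [Matrix.trace, Matrix.diag_apply, Matrix.mul_apply, Matrix.conjTranspose_apply]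
  push_cast
  refine Finset.sum_congr rfl fun i _ => Finset.sum_congr rfl fun j _ => ?_
  rw [← Complex.conj_mul']
  rfl

theorem norm_unitary_mul {n : ℕ} {U : Matrix (Fin n) (Fin n) ℂ} (hU : Uᴴ * U = 1)
    (M : Matrix (Fin n) (Fin n) ℂ) : ‖U * M‖ = ‖M‖ := by
  have h : ((‖U * M‖ ^ 2 : ℝ) : ℂ) = ((‖M‖ ^ 2 : ℝ) : ℂ) := by
    rw [← trace_conjTranspose_mul_self_eq, ← trace_conjTranspose_mul_self_eq,
      conjTranspose_mul, Matrix.mul_assoc, ← Matrix.mul_assoc Uᴴ, hU, Matrix.one_mul]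
  exact (sq_eq_sq₀ (norm_nonneg _) (norm_nonneg _)).1 (Complex.ofReal_injective h)

theorem norm_mul_unitary {n : ℕ} {U : Matrix (Fin n) (Fin n) ℂ} (hU : U * Uᴴ = 1)
    (M : Matrix (Fin n) (Fin n) ℂ) : ‖M * U‖ = ‖M‖ := by
  rw [← frobenius_norm_conjTranspose, conjTranspose_mul, norm_unitary_mul (by simpa using hU),
    frobenius_norm_conjTranspose]

/-! ### Matching of spectra and the Hoffman–Wielandt inequality. -/

/-- Two lists indexed by `Fin n` with the same multiset of values differ by a permutation. -/
theorem exists_perm_of_map_eq {α : Type*} {n : ℕ} {f g : Fin n → α}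
    (h : Finset.univ.val.map f = Finset.univ.val.map g) :
    ∃ σ : Equiv.Perm (Fin n), f ∘ σ = g := by
  classical
  -- Equal multiplicities give bijections between the fibres over each value; these glue to a
  -- permutation.
  have hc : ∀ a, Nonempty ({i // g i = a} ≃ {i // f i = a}) := fun a => by
    refine ⟨Fintype.equivOfCardEq ?_⟩
    have h' := congrArg (Multiset.count a) h
    rw [Multiset.count_map, Multiset.count_map] at h'
    rw [Fintype.card_subtype, Fintype.card_subtype]
    simp only [Finset.card_def, Finset.filter_val, eq_comm (b := a)]
    exact h'.symm
  let e := fun a => (hc a).some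
  refine ⟨Equiv.ofFiberEquiv (f := g) (g := f) e, ?_⟩
  funext i
  exact Equiv.ofFiberEquiv_map _ _

/-- The Hoffman–Wielandt inequality for a unitarily diagonalised matrix and a diagonal one. -/
theorem exists_perm_sum_le_norm_sq {n : ℕ} {V : Matrix (Fin n) (Fin n) ℂ} (h₁ : Vᴴ * V = 1)
    (h₂ : V * Vᴴ = 1) (c d : Fin n → ℂ) :
    ∃ π : Equiv.Perm (Fin n),
      ∑ i, ‖c (π i) - d i‖ ^ 2 ≤ ‖Vᴴ * diagonal d * V - diagonal c‖ ^ 2 := by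
  have hnorm : ‖Vᴴ * diagonal d * V - diagonal c‖ ^ 2
      = ∑ i, ∑ j, ‖V i j‖ ^ 2 * ‖c j - d i‖ ^ 2 := by
    rw [← norm_unitary_mul h₁, Matrix.mul_sub, ← Matrix.mul_assoc, ← Matrix.mul_assoc, h₂,
      Matrix.one_mul, frobenius_norm_sq]
    refine Finset.sum_congr rfl fun i _ => Finset.sum_congr rfl fun j _ => ?_
    rw [Matrix.sub_apply, diagonal_mul, mul_diagonal, ← mul_pow, ← norm_mul, ← norm_neg]
    congr 2
    ring
  -- The rows and columns of `V` are unit vectors.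
  have hS : (Matrix.of fun i j => ‖V i j‖ ^ 2) ∈ doublyStochastic ℝ (Fin n) := by
    rw [mem_doublyStochastic_iff_sum]
    refine ⟨fun i j => by simp, fun i => ?_, fun j => ?_⟩
    · have h := congrFun (congrFun h₂ i) i
      simp only [Matrix.mul_apply, conjTranspose_apply, one_apply_eq] at h
      apply Complex.ofReal_injective
      push_cast
      rw [← h]
      refine Finset.sum_congr rfl fun j _ => ?_
      simp [← Complex.mul_conj']
    · have h := congrFun (congrFun h₁ j) j
      simp only [Matrix.mul_apply, conjTranspose_apply, one_apply_eq] at h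
      apply Complex.ofReal_injective
      push_cast
      rw [← h]
      refine Finset.sum_congr rfl fun i _ => ?_
      simp [← Complex.conj_mul']
  obtain ⟨w, hw, hw1, hwS⟩ := exists_eq_sum_perm_of_mem_doublyStochastic hS
  have hsum : ∑ i, ∑ j, ‖V i j‖ ^ 2 * ‖c j - d i‖ ^ 2
      = ∑ σ : Equiv.Perm (Fin n), w σ * ∑ i, ‖c (σ i) - d i‖ ^ 2 := by
    have hV : ∀ i j, ‖V i j‖ ^ 2 = ∑ σ : Equiv.Perm (Fin n), if σ i = j then w σ else 0 := by
      intro i j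
      have h := congrFun (congrFun hwS i) j
      rw [Matrix.of_apply] at h
      rw [← h, Matrix.sum_apply]
      refine Finset.sum_congr rfl fun σ _ => ?_
      simp [Equiv.toPEquiv_apply, PEquiv.toMatrix_apply]
    simp only [hV, Finset.sum_mul, Finset.mul_sum]
    calc _ = ∑ i, ∑ σ : Equiv.Perm (Fin n), ∑ j,
          (if σ i = j then w σ else 0) * ‖c j - d i‖ ^ 2 :=
          Finset.sum_congr rfl fun i _ => Finset.sum_comm
      _ = ∑ i, ∑ σ : Equiv.Perm (Fin n), w σ * ‖c (σ i) - d i‖ ^ 2 := by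
          refine Finset.sum_congr rfl fun i _ => Finset.sum_congr rfl fun σ _ => ?_
          simp [ite_mul]
      _ = _ := Finset.sum_comm
  rw [hnorm, hsum]
  -- By Birkhoff the right side is a weighted average of the permutation costs, so it cannot lie
  -- below all of them.
  by_contra! hcon
  have hlt : ∑ σ : Equiv.Perm (Fin n),
      w σ * (∑ τ : Equiv.Perm (Fin n), w τ * ∑ i, ‖c (τ i) - d i‖ ^ 2)
      < ∑ σ : Equiv.Perm (Fin n), w σ * ∑ i, ‖c (σ i) - d i‖ ^ 2 := by
    obtain ⟨σ, hσ⟩ : ∃ σ, 0 < w σ := by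
      by_contra! h0
      have : ∑ σ, w σ ≤ 0 := Finset.sum_nonpos fun σ _ => h0 σ
      linarith
    exact Finset.sum_lt_sum (fun τ _ => mul_le_mul_of_nonneg_left (hcon τ).le (hw τ))
      ⟨σ, Finset.mem_univ _, mul_lt_mul_of_pos_left (hcon σ) hσ⟩
  rw [← Finset.sum_mul, hw1, one_mul] at hlt
  exact lt_irrefl _ hlt

/-! ### Flow argument for normal matrices. -/

/-- In a normal matrix, row and column sums of squared entries agree. -/
theorem sum_row_eq_sum_col_of_normal {n : ℕ} {X : Matrix (Fin n) (Fin n) ℂ}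
    (hX : X * Xᴴ = Xᴴ * X) (a : Fin n) : ∑ b, ‖X a b‖ ^ 2 = ∑ b, ‖X b a‖ ^ 2 := by
  have h := congrFun (congrFun hX a) a
  simp only [Matrix.mul_apply, conjTranspose_apply] at h
  apply Complex.ofReal_injective
  push_cast
  calc _ = ∑ b, X a b * star (X a b) :=
        Finset.sum_congr rfl fun b _ => (Complex.mul_conj' _).symm
    _ = _ := h.trans (Finset.sum_congr rfl fun b _ => Complex.conj_mul' _)

/-- If all row sums of `x` equal the corresponding column sums, then so do the total flows out of
and into any set of indices. -/
theorem sum_boundary_eq {ι : Type*} [Fintype ι] {x : ι → ι → ℝ}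
    (hx : ∀ a, ∑ b, x a b = ∑ b, x b a) (P : ι → Prop) [DecidablePred P] :
    ∑ a, ∑ b, (if P a ∧ ¬ P b then x a b else 0) = ∑ a, ∑ b, if P a ∧ ¬ P b then x b a else 0 := by
  -- The flow out of `P` is the sum of the rows in `P` minus the flow inside `P`, and the latter is
  -- unchanged by transposition.
  have hsplit : ∀ f : ι → ι → ℝ, ∑ a, ∑ b, (if P a ∧ ¬ P b then f a b else 0)
      = ∑ a, (if P a then ∑ b, f a b else 0) - ∑ a, ∑ b, if P a ∧ P b then f a b else 0 := by
    intro f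
    rw [← Finset.sum_sub_distrib]
    refine Finset.sum_congr rfl fun a _ => ?_
    by_cases ha : P a
    · simp only [ha, true_and, if_true]
      rw [← Finset.sum_sub_distrib]
      refine Finset.sum_congr rfl fun b _ => ?_
      by_cases hb : P b <;> simp [hb]
    · simp [ha]
  rw [hsplit, hsplit fun a b => x b a]
  congr 1
  · exact Finset.sum_congr rfl fun a _ => by rw [hx]
  · rw [Finset.sum_comm]
    simp only [and_comm]

/-- Bound for the part of a balanced nonnegative array above the diagonal of its diagonal blocks
(blocks `blk`, position `pos` within a block) by the remaining part. -/
theorem sum_upper_le_of_balanced {ι β : Type*} [Fintype ι] [DecidableEq β]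
    (blk : ι → β) (pos : ι → ℕ) (K : ℕ)
    (hK : ∀ a, (Finset.univ.filter fun q => blk q = blk a ∧ pos a < pos q).card + 1 ≤ K)
    {x y : ι → ι → ℝ} (hx0 : ∀ a b, 0 ≤ x a b) (hy0 : ∀ a b, 0 ≤ y a b)
    (hx : ∀ a, ∑ b, x a b = ∑ b, x b a)
    (hxy : ∀ a b, a ≠ b → ¬ (blk a = blk b ∧ pos a < pos b) → x a b = y a b) :
    ∑ a, ∑ b, (if blk a = blk b ∧ pos a < pos b then x a b else 0)
      ≤ ((K : ℝ) - 1) * ∑ a, ∑ b, y a b := by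
  let P : ι → ι → Prop := fun q a => blk q = blk a ∧ pos a < pos q
  have hflow : ∑ q, ∑ a, ∑ b, (if P q a ∧ ¬ P q b then x a b else 0)
      = ∑ q, ∑ a, ∑ b, if P q a ∧ ¬ P q b then x b a else 0 :=
    Finset.sum_congr rfl fun q _ => sum_boundary_eq hx (P q)
  -- An upper entry `(a, q)` leaves the set `P q` of predecessors of `q`, since `q` is not its own
  -- predecessor.
  have hlow : ∑ a, ∑ b, (if blk a = blk b ∧ pos a < pos b then x a b else 0)
      ≤ ∑ q, ∑ a, ∑ b, (if P q a ∧ ¬ P q b then x a b else 0) := by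
    rw [Finset.sum_comm]
    refine Finset.sum_le_sum fun q _ => Finset.sum_le_sum fun a _ => ?_
    have hnn : ∀ b ∈ Finset.univ, 0 ≤ (if P q a ∧ ¬ P q b then x a b else 0) := fun b _ => by
      split_ifs
      exacts [hx0 _ _, le_rfl]
    refine le_trans ?_ (Finset.single_le_sum hnn (Finset.mem_univ q))
    by_cases h : blk a = blk q ∧ pos a < pos q
    · rw [if_pos h, if_pos ⟨⟨h.1.symm, h.2⟩, fun h' => lt_irrefl _ h'.2⟩]
    · rw [if_neg h]
      split_ifs
      exacts [hx0 _ _, le_rfl]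
  -- An entry coming into `P q` from outside is never upper: a predecessor of a member of `P q` is
  -- again in `P q`. Hence `x = y` there.
  have hup : ∑ q, ∑ a, ∑ b, (if P q a ∧ ¬ P q b then x b a else 0)
      ≤ ∑ q, ∑ a, ∑ b, (if P q a then y b a else 0) := by
    refine Finset.sum_le_sum fun q _ => Finset.sum_le_sum fun a _ =>
      Finset.sum_le_sum fun b _ => ?_
    by_cases h : P q a ∧ ¬ P q b
    · rw [if_pos h, if_pos h.1]
      refine (hxy b a (fun hba => h.2 (hba ▸ h.1)) fun hu => h.2 ⟨h.1.1.trans hu.1.symm, ?_⟩).le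
      exact hu.2.trans h.1.2
    · rw [if_neg h]
      split_ifs
      exacts [hy0 _ _, le_rfl]
  -- Column `a` is counted once for each `q` later in its block, at most `K - 1` times.
  have hcount : ∑ q, ∑ a, ∑ b, (if P q a then y b a else 0)
      ≤ ((K : ℝ) - 1) * ∑ a, ∑ b, y a b := by
    rw [Finset.sum_comm, Finset.sum_comm (f := fun a b => y a b), Finset.mul_sum]
    refine Finset.sum_le_sum fun a _ => ?_
    have : ∑ q, ∑ b, (if P q a then y b a else 0)
        = ((Finset.univ.filter fun q => P q a).card : ℝ) * ∑ b, y b a := by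
      rw [Finset.card_eq_sum_ones, Finset.sum_filter, Nat.cast_sum, Finset.sum_mul]
      refine Finset.sum_congr rfl fun q _ => ?_
      by_cases h : P q a <;> simp [h]
    rw [this]
    refine mul_le_mul_of_nonneg_right ?_ (Finset.sum_nonneg fun b _ => hy0 _ _)
    have := hK a
    have h2 : ((Finset.univ.filter fun q => P q a).card : ℝ) + 1 ≤ K := by exact_mod_cast this
    linarith
  linarith

/-- If `X` is normal and `X + Y` is block diagonal with upper triangular blocks of order at most
`K`, then `X` is within `√K ‖Y‖` of the diagonal of `X + Y`. -/
theorem norm_sub_diagonal_sq_le {n : ℕ} {β : Type*} [DecidableEq β]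
    (blk : Fin n → β) (pos : Fin n → ℕ) (K : ℕ)
    (hK : ∀ a, (Finset.univ.filter fun q => blk q = blk a ∧ pos a < pos q).card + 1 ≤ K)
    {X Y : Matrix (Fin n) (Fin n) ℂ} (hX : X * Xᴴ = Xᴴ * X)
    (hXY : ∀ a b, a ≠ b → ¬ (blk a = blk b ∧ pos a < pos b) → X a b + Y a b = 0) :
    ‖X - diagonal (fun a => X a a + Y a a)‖ ^ 2 ≤ K * ‖Y‖ ^ 2 := by
  have hoff : ∀ a b, a ≠ b → ¬ (blk a = blk b ∧ pos a < pos b) →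
      ‖X a b‖ ^ 2 = ‖Y a b‖ ^ 2 := fun a b hab hu => by
    rw [eq_neg_of_add_eq_zero_left (hXY a b hab hu), norm_neg]
  have hup := sum_upper_le_of_balanced blk pos K hK (x := fun a b => ‖X a b‖ ^ 2)
    (y := fun a b => ‖Y a b‖ ^ 2) (fun _ _ => by positivity) (fun _ _ => by positivity)
    (sum_row_eq_sum_col_of_normal hX) hoff
  rw [frobenius_norm_sq, frobenius_norm_sq]
  -- Diagonal entries of the difference are `-Y a a`, and non-upper ones agree with `Y` in modulus.
  -- This single copy of `‖Y‖²` raises the factor from `K - 1` to `K`.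
  have hentry : ∑ a, ∑ b, ‖(X - diagonal (fun a => X a a + Y a a)) a b‖ ^ 2
      ≤ ∑ a, ∑ b, ((if blk a = blk b ∧ pos a < pos b then ‖X a b‖ ^ 2 else 0) + ‖Y a b‖ ^ 2) := by
    refine Finset.sum_le_sum fun a _ => Finset.sum_le_sum fun b _ => ?_
    rw [Matrix.sub_apply]
    by_cases hab : a = b
    · subst hab
      simp
    · rw [diagonal_apply_ne _ hab, sub_zero]
      by_cases hu : blk a = blk b ∧ pos a < pos b
      · rw [if_pos hu]
        nlinarith [sq_nonneg ‖Y a b‖]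
      · rw [if_neg hu, hoff a b hab hu, zero_add]
  simp only [Finset.sum_add_distrib] at hentry
  linarith

/-! ### Schur triangularisation and block-diagonal matrices. -/

section

/-- Every eigenvector can be taken as the first column of a unitary matrix. -/
theorem exists_unitary_first_col_eigenvector {n : ℕ} (M : Matrix (Fin (n + 1)) (Fin (n + 1)) ℂ) :
    ∃ W : Matrix (Fin (n + 1)) (Fin (n + 1)) ℂ, Wᴴ * W = 1 ∧
      ∃ c : ℂ, ∀ i, (M * W) i 0 = c * W i 0 := by
  obtain ⟨c, hc⟩ := Module.End.exists_eigenvalue (Matrix.toLin' M)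
  obtain ⟨v, hv⟩ := hc.exists_hasEigenvector
  have hv0 : WithLp.toLp 2 v ≠ 0 := by simpa using hv.2
  let u : EuclideanSpace ℂ (Fin (n + 1)) := ((‖WithLp.toLp 2 v‖ : ℂ)⁻¹) • WithLp.toLp 2 v
  have hu : ‖u‖ = 1 := norm_smul_inv_norm hv0
  -- Only the vector at index `0` is prescribed; the others come from extension to an orthonormal
  -- basis.
  have horth : Orthonormal ℂ (({0} : Set (Fin (n + 1))).domRestrict fun _ => u) := by
    rw [orthonormal_iff_ite]
    rintro ⟨i, rfl⟩ ⟨j, rfl⟩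
    simp [inner_self_eq_norm_sq_to_K, hu]
  obtain ⟨b, hb⟩ := horth.exists_orthonormalBasis_extension_of_card_eq (by simp)
  have hb0 : b 0 = u := hb 0 rfl
  refine ⟨Matrix.of fun i j => b j i, ?_, c, fun i => ?_⟩
  · ext i j
    have h := orthonormal_iff_ite.1 b.orthonormal i j
    rw [Matrix.mul_apply, one_apply, ← h, PiLp.inner_apply]
    refine Finset.sum_congr rfl fun l _ => ?_
    simp [mul_comm]
  · have h := congrFun (Module.End.mem_eigenspace_iff.1 hv.1) i
    simp only [toLin'_apply, mulVec, dotProduct, Pi.smul_apply, smul_eq_mul] at h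
    simp only [Matrix.mul_apply, of_apply, hb0, u, PiLp.smul_apply, smul_eq_mul]
    rw [mul_left_comm, ← h, Finset.mul_sum]
    exact Finset.sum_congr rfl fun l _ => mul_left_comm _ _ _

/-- Schur's unitary triangularisation. -/
theorem exists_unitary_upperTriangular (n : ℕ) (M : Matrix (Fin n) (Fin n) ℂ) :
    ∃ W : Matrix (Fin n) (Fin n) ℂ, Wᴴ * W = 1 ∧ ∀ i j, j < i → (Wᴴ * M * W) i j = 0 := by
  induction n with
  | zero => exact ⟨1, by simp, fun i => i.elim0⟩
  | succ n ih =>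
    obtain ⟨V, hV, c, hc⟩ := exists_unitary_first_col_eigenvector M
    set N := Vᴴ * M * V with hN
    -- The first column of `N` is `c` times that of `Vᴴ * V = 1`.
    have hcol : ∀ i : Fin n, N i.succ 0 = 0 := fun i => by
      have h := congrFun (congrFun hV i.succ) 0
      rw [Matrix.mul_apply, one_apply_ne (Fin.succ_ne_zero i)] at h
      rw [hN, Matrix.mul_assoc, Matrix.mul_apply]
      simp only [hc, mul_left_comm _ c]
      rw [← Finset.mul_sum, h, mul_zero]
    obtain ⟨W, hW, hup⟩ := ih (N.submatrix Fin.succ Fin.succ)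
    -- `D = diag(1, W)`, with `W` triangularising the trailing block.
    let D : Matrix (Fin (n + 1)) (Fin (n + 1)) ℂ :=
      Matrix.of (Fin.cons (Fin.cons 1 0) fun i => Fin.cons 0 (W i))
    have h00 : D 0 0 = 1 := rfl
    have h0s : ∀ j : Fin n, D 0 j.succ = 0 := fun _ => rfl
    have hs0 : ∀ i : Fin n, D i.succ 0 = 0 := fun _ => rfl
    have hss : ∀ i j : Fin n, D i.succ j.succ = W i j := fun _ _ => rfl
    refine ⟨V * D, ?_, ?_⟩
    · have hD : Dᴴ * D = 1 := by
        ext i j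
        refine Fin.cases ?_ (fun i => ?_) i <;> refine Fin.cases ?_ (fun j => ?_) j <;>
          simp only [Matrix.mul_apply, Fin.sum_univ_succ, conjTranspose_apply, h00, h0s, hs0, hss]
        · simp
        · simp [one_apply, (Fin.succ_ne_zero j).symm]
        · simp [one_apply]
        · have h := congrFun (congrFun hW i) j
          simp only [Matrix.mul_apply, conjTranspose_apply] at h
          simpa [one_apply] using h
      rw [conjTranspose_mul, Matrix.mul_assoc, ← Matrix.mul_assoc Vᴴ, hV, Matrix.one_mul, hD]
    · have hconj : (V * D)ᴴ * M * (V * D) = Dᴴ * N * D := by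
        simp only [hN, conjTranspose_mul, Matrix.mul_assoc]
      rw [hconj]
      intro i j hij
      obtain ⟨i, rfl⟩ := Fin.exists_succ_eq.2 (Fin.ne_zero_of_lt hij)
      refine Fin.cases (fun _ => ?_) (fun j hij => ?_) j hij
      · simp [Matrix.mul_apply, Fin.sum_univ_succ, h00, h0s, hs0, hss, hcol]
      · have h := hup i j (Fin.succ_lt_succ_iff.1 hij)
        rw [← h]
        simp [Matrix.mul_apply, Fin.sum_univ_succ, h0s, hss]

/-- The position of the `c`-th index of block `i` in the consecutive enumeration. -/
def blockEquiv {n p : ℕ} (k : Fin p → ℕ) (hk : ∑ i, k i = n) : (Σ i, Fin (k i)) ≃ Fin n :=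
  finSigmaFinEquiv.trans (finCongr hk)

theorem blockDiag_eq_submatrix {n p : ℕ} (k : Fin p → ℕ) (hk : ∑ i, k i = n)
    (B : ∀ i, Matrix (Fin (k i)) (Fin (k i)) ℂ) :
    blockDiag k hk B
      = (blockDiagonal' B).submatrix (blockEquiv k hk).symm (blockEquiv k hk).symm := rfl

theorem blockEquiv_lt {n p : ℕ} (k : Fin p → ℕ) (hk : ∑ i, k i = n) {i : Fin p} {c d : Fin (k i)} :
    blockEquiv k hk ⟨i, c⟩ < blockEquiv k hk ⟨i, d⟩ ↔ c < d := by
  rw [Fin.lt_def, Fin.lt_def]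
  simp [blockEquiv]

variable {n p : ℕ} (k : Fin p → ℕ) (hk : ∑ i, k i = n)

theorem blockDiag_mul (B C : ∀ i, Matrix (Fin (k i)) (Fin (k i)) ℂ) :
    blockDiag k hk B * blockDiag k hk C = blockDiag k hk fun i => B i * C i := by
  simp only [blockDiag_eq_submatrix, blockDiagonal'_mul]
  exact submatrix_mul_equiv _ _ _ _ _

theorem blockDiag_conjTranspose (B : ∀ i, Matrix (Fin (k i)) (Fin (k i)) ℂ) :
    (blockDiag k hk B)ᴴ = blockDiag k hk fun i => (B i)ᴴ := by
  simp only [blockDiag_eq_submatrix, conjTranspose_submatrix, blockDiagonal'_conjTranspose]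

theorem blockDiag_one : blockDiag k hk (fun _ => 1) = 1 := by
  rw [blockDiag_eq_submatrix]
  change (blockDiagonal' 1).submatrix _ _ = 1
  rw [blockDiagonal'_one, submatrix_one_equiv]

theorem blockDiag_add (B C : ∀ i, Matrix (Fin (k i)) (Fin (k i)) ℂ) :
    blockDiag k hk B + blockDiag k hk C = blockDiag k hk fun i => B i + C i := by
  simp only [blockDiag_eq_submatrix]
  change _ = (blockDiagonal' (B + C)).submatrix _ _
  rw [blockDiagonal'_add, submatrix_add]
  rfl

theorem blockDiag_diagonal (d : ∀ i, Fin (k i) → ℂ) :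
    blockDiag k hk (fun i => diagonal (d i))
      = diagonal fun a => d ((blockEquiv k hk).symm a).1 ((blockEquiv k hk).symm a).2 := by
  rw [blockDiag_eq_submatrix, blockDiagonal'_diagonal, submatrix_diagonal_equiv]
  rfl

theorem blockDiag_apply_blockEquiv (B : ∀ i, Matrix (Fin (k i)) (Fin (k i)) ℂ)
    (x y : Σ i, Fin (k i)) :
    blockDiag k hk B (blockEquiv k hk x) (blockEquiv k hk y) = blockDiagonal' B x y := by
  simp [blockDiag_eq_submatrix]

theorem blockDiag_isUpperTriangular {B : ∀ i, Matrix (Fin (k i)) (Fin (k i)) ℂ}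
    (hB : ∀ i a b, b < a → B i a b = 0) : (blockDiag k hk B).IsUpperTriangular := by
  intro a b hab
  obtain ⟨⟨i, c⟩, rfl⟩ := (blockEquiv k hk).surjective a
  obtain ⟨⟨j, d⟩, rfl⟩ := (blockEquiv k hk).surjective b
  rw [blockDiag_apply_blockEquiv]
  by_cases hij : i = j
  · subst hij
    rw [blockDiagonal'_apply_eq]
    exact hB i c d ((blockEquiv_lt k hk).1 hab)
  · exact blockDiagonal'_apply_ne _ _ _ hij

theorem roots_charpoly_of_isUpperTriangular {M : Matrix (Fin n) (Fin n) ℂ}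
    (hM : M.IsUpperTriangular) : M.charpoly.roots = Finset.univ.val.map fun i => M i i := by
  rw [charpoly_of_isUpperTriangular M hM]
  exact Polynomial.roots_multiset_prod_X_sub_C (Finset.univ.val.map fun i => M i i) ▸ by
    rw [Multiset.map_map]; rfl

/-- The other `p - 1` blocks occupy at least `p - 1` indices. This is the source of the factor `n +
1 - s`. -/
theorem order_add_count_le (hk : ∑ i, k i = n) (hpos : ∀ i, 0 < k i) (i : Fin p) : k i + p ≤ n + 1 := by
  have h : ∑ j ∈ Finset.univ.erase i, 1 ≤ ∑ j ∈ Finset.univ.erase i, k j :=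
    Finset.sum_le_sum fun j _ => hpos j
  have h2 := Finset.add_sum_erase Finset.univ k (Finset.mem_univ i)
  have := i.pos
  simp only [Finset.sum_const, smul_eq_mul, mul_one, Finset.card_erase_of_mem (Finset.mem_univ i),
    Finset.card_univ, Fintype.card_fin] at h
  omega

theorem card_later_in_block (a : Fin n) :
    (Finset.univ.filter fun q => ((blockEquiv k hk).symm q).1 = ((blockEquiv k hk).symm a).1 ∧
      (((blockEquiv k hk).symm a).2 : ℕ) < ((blockEquiv k hk).symm q).2).card + 1
      ≤ k ((blockEquiv k hk).symm a).1 := by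
  obtain ⟨⟨i, c⟩, rfl⟩ := (blockEquiv k hk).surjective a
  rw [Equiv.symm_apply_apply]
  change (Finset.univ.filter fun q => ((blockEquiv k hk).symm q).1 = i ∧
    (c : ℕ) < ((blockEquiv k hk).symm q).2).card + 1 ≤ k i
  have hsub : (Finset.univ.filter fun q => ((blockEquiv k hk).symm q).1 = i ∧
      (c : ℕ) < ((blockEquiv k hk).symm q).2)
      ⊆ (Finset.univ.erase c).image fun d => blockEquiv k hk ⟨i, d⟩ := by
    intro q hq
    obtain ⟨⟨j, d⟩, rfl⟩ := (blockEquiv k hk).surjective q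
    simp only [Finset.mem_filter, Finset.mem_univ, true_and] at hq
    rw [Equiv.symm_apply_apply] at hq
    obtain ⟨rfl, hcd⟩ := hq
    exact Finset.mem_image.2 ⟨d, Finset.mem_erase.2 ⟨fun h => by rw [h] at hcd; exact lt_irrefl _ hcd,
      Finset.mem_univ _⟩, rfl⟩
  have h := (Finset.card_le_card hsub).trans Finset.card_image_le
  rw [Finset.card_erase_of_mem (Finset.mem_univ c), Finset.card_univ, Fintype.card_fin] at h
  have := c.pos
  omega

end

/-! ### Centring by the trace. -/

/-- Pythagoras: subtracting the mean projects `F` orthogonally onto the trace-zero matrices. -/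
theorem norm_sub_mean_sq {n : ℕ} (F : Matrix (Fin n) (Fin n) ℂ) :
    ‖F - (F.trace / n) • (1 : Matrix (Fin n) (Fin n) ℂ)‖ ^ 2
      = ‖F‖ ^ 2 - 1 / (n : ℝ) * ‖F.trace‖ ^ 2 := by
  rcases Nat.eq_zero_or_pos n with rfl | hn
  · simp [frobenius_norm_sq]
  have hn' : (n : ℂ) ≠ 0 := by exact_mod_cast hn.ne'
  apply Complex.ofReal_injective
  rw [← trace_conjTranspose_mul_self_eq]
  have h1 : (((‖F‖ ^ 2 - 1 / (n : ℝ) * ‖F.trace‖ ^ 2 : ℝ)) : ℂ)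
      = (Fᴴ * F).trace - 1 / n * (star F.trace * F.trace) := by
    rw [trace_conjTranspose_mul_self_eq, show star F.trace * F.trace = (‖F.trace‖ : ℂ) ^ 2 from
      Complex.conj_mul' _]
    push_cast
    ring
  rw [h1]
  simp only [conjTranspose_sub, conjTranspose_smul, conjTranspose_one, Matrix.sub_mul,
    Matrix.mul_sub, Matrix.smul_mul, Matrix.mul_smul, Matrix.one_mul, Matrix.mul_one, trace_sub,
    trace_smul, trace_conjTranspose, trace_one, Fintype.card_fin, smul_eq_mul, star_div₀,
    star_natCast]
  field_simp
  ring

theorem delta_eq_norm {n : ℕ} (F : Matrix (Fin n) (Fin n) ℂ) :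
    delta F = ‖F - (F.trace / n) • (1 : Matrix (Fin n) (Fin n) ℂ)‖ := by
  rw [delta, ← norm_sub_mean_sq, Real.sqrt_sq (norm_nonneg _)]

theorem delta_sq {n : ℕ} (F : Matrix (Fin n) (Fin n) ℂ) :
    delta F ^ 2 = ‖F‖ ^ 2 - 1 / (n : ℝ) * ‖F.trace‖ ^ 2 := by
  rw [delta_eq_norm, norm_sub_mean_sq]

theorem delta_nonneg {n : ℕ} (F : Matrix (Fin n) (Fin n) ℂ) : 0 ≤ delta F :=
  Real.sqrt_nonneg _

/-- The sum of squares of a list, split into its deviation from the mean and the mean. -/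
theorem sum_norm_sub_mean_sq {n : ℕ} (x : Fin n → ℂ) {t : ℂ} (ht : ∑ i, x i = t) :
    ∑ i, ‖x i - t / n‖ ^ 2 = ∑ i, ‖x i‖ ^ 2 - 1 / (n : ℝ) * ‖t‖ ^ 2 := by
  have hd : ∀ y : Fin n → ℂ, ‖diagonal y‖ ^ 2 = ∑ i, ‖y i‖ ^ 2 := fun y => by
    rw [frobenius_norm_diagonal, EuclideanSpace.norm_sq_eq]
  have h := norm_sub_mean_sq (diagonal x)
  rw [trace_diagonal, ht, hd, smul_one_eq_diagonal, diagonal_sub, hd] at h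
  exact h

/-! ### Spectral variation of a perturbed diagonal matrix. -/

/-- A perturbation of a diagonal matrix which is unitarily similar to a block diagonal matrix with
`s` blocks: its spectrum is close to the unperturbed one. -/
theorem exists_perm_sum_sq_le {n s : ℕ} (d : Fin n → ℂ) (F : Matrix (Fin n) (Fin n) ℂ)
    (hs : s ∈ blockCounts (diagonal d + F)) {lam' : Fin n → ℂ}
    (hlam' : IsSpectrum (diagonal d + F) lam') :
    ∃ π : Equiv.Perm (Fin n), ∑ i, ‖lam' (π i) - d i‖ ^ 2
      ≤ ((n : ℝ) + 1 - s) * delta F ^ 2 + 1 / (n : ℝ) * ‖F.trace‖ ^ 2 := by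
  obtain ⟨U, hU, k, hk, B, hpos, hB⟩ := hs
  -- Triangularising block by block keeps the block structure.
  choose W hW hWB using fun i => exists_unitary_upperTriangular (k i) (B i)
  set V := U * blockDiag k hk W with hVdef
  have hV₁ : Vᴴ * V = 1 := by
    rw [hVdef, conjTranspose_mul, Matrix.mul_assoc, ← Matrix.mul_assoc Uᴴ,
      show Uᴴ * U = 1 from mem_unitaryGroup_iff'.1 hU, Matrix.one_mul, blockDiag_conjTranspose,
      blockDiag_mul]
    simp only [hW, blockDiag_one]
  have hV₂ : V * Vᴴ = 1 := mul_eq_one_comm.1 hV₁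
  set R := blockDiag k hk fun i => (W i)ᴴ * B i * W i with hR
  have hVR : Vᴴ * diagonal d * V + Vᴴ * F * V = R := by
    rw [hR, ← blockDiag_mul, ← blockDiag_mul, ← blockDiag_conjTranspose, ← hB, hVdef,
      conjTranspose_mul]
    simp only [Matrix.mul_assoc, Matrix.mul_add, Matrix.add_mul]
  have hRup : R.IsUpperTriangular := blockDiag_isUpperTriangular k hk hWB
  set c : Fin n → ℂ := fun i => R i i with hc
  have hchar : (diagonal d + F).charpoly = R.charpoly := by
    rw [← hVR, ← Matrix.add_mul, ← Matrix.mul_add, charpoly_mul_comm, ← Matrix.mul_assoc, hV₂,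
      Matrix.one_mul]
  have hspec : Finset.univ.val.map lam' = Finset.univ.val.map c := by
    rw [← roots_charpoly_of_isUpperTriangular hRup, ← hchar]
    exact hlam'.symm
  obtain ⟨σ, hσ⟩ := exists_perm_of_map_eq hspec
  set t : ℂ := F.trace with ht
  -- The eigenvalues are shifted by `t / n` so that only the centred part of `F` enters the norm
  -- bound.
  obtain ⟨π, hπ⟩ := exists_perm_sum_le_norm_sq hV₁ hV₂ (fun i => c i - t / n) d
  have hconj : Vᴴ * (F - (t / n) • (1 : Matrix (Fin n) (Fin n) ℂ)) * V
      = Vᴴ * F * V - (t / n) • (1 : Matrix (Fin n) (Fin n) ℂ) := by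
    rw [Matrix.mul_sub, Matrix.sub_mul, Matrix.mul_smul, Matrix.mul_one, Matrix.smul_mul, hV₁]
  have hnormY : ‖Vᴴ * F * V - (t / n) • (1 : Matrix (Fin n) (Fin n) ℂ)‖ = delta F := by
    rw [← hconj, norm_mul_unitary hV₂, norm_unitary_mul (by simpa using hV₂), delta_eq_norm]
  have hnormal : (Vᴴ * diagonal d * V) * (Vᴴ * diagonal d * V)ᴴ
      = (Vᴴ * diagonal d * V)ᴴ * (Vᴴ * diagonal d * V) := by
    have hm : ∀ X Y : Matrix (Fin n) (Fin n) ℂ, (Vᴴ * X * V) * (Vᴴ * Y * V) = Vᴴ * (X * Y) * V := by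
      intro X Y
      rw [show Vᴴ * X * V * (Vᴴ * Y * V) = Vᴴ * X * (V * Vᴴ) * (Y * V) by
        simp only [Matrix.mul_assoc], hV₂, Matrix.mul_one]
      simp only [Matrix.mul_assoc]
    have hct : (Vᴴ * diagonal d * V)ᴴ = Vᴴ * (diagonal d)ᴴ * V := by
      simp [conjTranspose_mul, Matrix.mul_assoc]
    rw [hct, hm, hm, diagonal_conjTranspose, diagonal_mul_diagonal, diagonal_mul_diagonal]
    simp only [mul_comm]
  have hsn : ∀ i, k i ≤ n + 1 - s := fun i => by
    have := order_add_count_le k hk hpos i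
    omega
  let e := (blockEquiv k hk).symm
  have hmain := norm_sub_diagonal_sq_le (fun a => (e a).1) (fun a => ((e a).2 : ℕ)) (n + 1 - s)
    (fun a => (card_later_in_block k hk a).trans (hsn _)) hnormal
    (Y := Vᴴ * F * V - (t / n) • (1 : Matrix (Fin n) (Fin n) ℂ)) (fun a b hab hu => by
      rw [Matrix.sub_apply, Matrix.smul_apply, one_apply_ne hab, smul_zero, sub_zero, ← Matrix.add_apply,
        hVR]
      obtain ⟨⟨i, x⟩, rfl⟩ := (blockEquiv k hk).surjective a
      obtain ⟨⟨j, y⟩, rfl⟩ := (blockEquiv k hk).surjective b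
      rw [hR, blockDiag_apply_blockEquiv]
      by_cases hij : i = j
      · subst hij
        rw [blockDiagonal'_apply_eq]
        refine hWB i x y (lt_of_le_of_ne ?_ fun h => hab (by rw [h]))
        simp only [e] at hu
        rw [Equiv.symm_apply_apply, Equiv.symm_apply_apply] at hu
        exact not_lt.1 fun h => hu ⟨rfl, h⟩
      · exact blockDiagonal'_apply_ne _ _ _ hij)
  have hdiag : (fun a => (Vᴴ * diagonal d * V) a a
      + (Vᴴ * F * V - (t / n) • (1 : Matrix (Fin n) (Fin n) ℂ)) a a) = fun i => c i - t / n := by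
    funext a
    rw [Matrix.sub_apply, ← add_sub_assoc, ← Matrix.add_apply, hVR]
    simp [hc]
  rw [hdiag, hnormY] at hmain
  have hcast : ((n + 1 - s : ℕ) : ℝ) = (n : ℝ) + 1 - s := by
    have : s ≤ n := le_of_mem_blockCounts ⟨U, hU, k, hk, B, hpos, hB⟩
    rw [Nat.cast_sub (by omega)]
    push_cast
    ring
  rw [hcast] at hmain
  -- The total eigenvalue displacement is `tr F` for every matching, so the shift is by its mean and
  -- costs exactly `|t|²/n`.
  have htr : ∑ i, (c (π i) - d i) = t := by
    have h1 : R.trace = ∑ i, d i + t := by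
      rw [← hVR, trace_add, trace_mul_comm, ← Matrix.mul_assoc, hV₂, Matrix.one_mul,
        trace_mul_comm (Vᴴ * F), ← Matrix.mul_assoc, hV₂, Matrix.one_mul, trace_diagonal]
    rw [Finset.sum_sub_distrib, Equiv.sum_comp π c, show ∑ i, c i = R.trace from rfl, h1]
    ring
  have hmean := sum_norm_sub_mean_sq (fun i => c (π i) - d i) htr
  refine ⟨π.trans σ, ?_⟩
  have hlc : ∀ i, lam' ((π.trans σ) i) = c (π i) := fun i => congrFun hσ (π i)
  simp only [hlc]
  have hre : ∀ i, c (π i) - d i - t / n = c (π i) - t / n - d i := fun i => by ring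
  simp only [hre] at hmean
  linarith

/-! ### Jordan matrices and their scaling. -/

section

variable {n p : ℕ} (k : Fin p → ℕ) (hk : ∑ i, k i = n)

/-- The nilpotent part of a Jordan matrix with blocks of orders `k i`. -/
noncomputable def jordanNilpotent : Matrix (Fin n) (Fin n) ℂ :=
  blockDiag k hk fun i => jordanBlock (k i) 0

/-- The diagonal of a Jordan matrix with blocks of orders `k i` and eigenvalues `μ i`. -/
noncomputable def jordanDiag (μ : Fin p → ℂ) (a : Fin n) : ℂ := μ ((blockEquiv k hk).symm a).1

/-- The position of an index within its block. -/
def blockPos (a : Fin n) : ℕ := ((blockEquiv k hk).symm a).2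

theorem blockDiag_jordanBlock (μ : Fin p → ℂ) :
    blockDiag k hk (fun i => jordanBlock (k i) (μ i))
      = diagonal (jordanDiag k hk μ) + jordanNilpotent k hk := by
  unfold jordanNilpotent jordanDiag
  rw [← blockDiag_diagonal k hk fun i _ => μ i, blockDiag_add]
  congr 1
  funext i
  ext a b
  by_cases h : a = b
  · subst h
    simp [jordanBlock]
  · simp [jordanBlock, h]

theorem blockDiag_jordanBlock_isUpperTriangular (μ : Fin p → ℂ) :
    (blockDiag k hk fun i => jordanBlock (k i) (μ i)).IsUpperTriangular := by
  refine blockDiag_isUpperTriangular k hk fun i a b hab => ?_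
  have h2 : ¬ ((a : ℕ) + 1 = b) := by
    have := Fin.lt_def.1 hab
    omega
  simp [jordanBlock, hab.ne', h2]

theorem jordanNilpotent_apply_self (a : Fin n) : jordanNilpotent k hk a a = 0 := by
  obtain ⟨⟨i, c⟩, rfl⟩ := (blockEquiv k hk).surjective a
  rw [jordanNilpotent, blockDiag_apply_blockEquiv, blockDiagonal'_apply_eq]
  simp [jordanBlock]

theorem trace_jordanNilpotent : (jordanNilpotent k hk).trace = 0 :=
  Finset.sum_eq_zero fun a _ => jordanNilpotent_apply_self k hk a

theorem diagonal_jordanDiag_apply (μ : Fin p → ℂ) (a : Fin n) :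
    blockDiag k hk (fun i => jordanBlock (k i) (μ i)) a a = jordanDiag k hk μ a := by
  rw [blockDiag_jordanBlock, Matrix.add_apply, jordanNilpotent_apply_self, diagonal_apply_eq,
    add_zero]

theorem blockPos_of_jordanNilpotent_ne_zero {a b : Fin n} (h : jordanNilpotent k hk a b ≠ 0) :
    blockPos k hk b = blockPos k hk a + 1 := by
  unfold blockPos
  obtain ⟨⟨i, c⟩, rfl⟩ := (blockEquiv k hk).surjective a
  obtain ⟨⟨j, d⟩, rfl⟩ := (blockEquiv k hk).surjective b
  rw [jordanNilpotent, blockDiag_apply_blockEquiv] at h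
  by_cases hij : i = j
  · subst hij
    rw [blockDiagonal'_apply_eq] at h
    rw [Equiv.symm_apply_apply, Equiv.symm_apply_apply]
    by_contra h'
    have h2 : ¬ ((c : ℕ) + 1 = d) := fun h2 => h' h2.symm
    exact h (by simp [jordanBlock, h2])
  · exact absurd (blockDiagonal'_apply_ne _ _ _ hij) h

theorem blockPos_lt (a : Fin n) : blockPos k hk a < Finset.univ.sup k :=
  (Fin.is_lt _).trans_le (Finset.le_sup (f := k) (Finset.mem_univ _))

/-- Each column except the first contains exactly one `1`. -/
theorem sum_norm_jordanBlock_zero_sq (m : ℕ) (hm : 0 < m) :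
    ∑ c, ∑ d, ‖jordanBlock m 0 c d‖ ^ 2 = (m : ℝ) - 1 := by
  obtain ⟨m, rfl⟩ := Nat.exists_eq_succ_of_ne_zero hm.ne'
  rw [Finset.sum_comm, Fin.sum_univ_succ]
  have h0 : ∀ c, ‖jordanBlock (m + 1) 0 c 0‖ ^ 2 = 0 := fun c => by simp [jordanBlock]
  have hs : ∀ (d : Fin m) c, ‖jordanBlock (m + 1) 0 c d.succ‖ ^ 2
      = if c = d.castSucc then 1 else 0 := fun d c => by
    by_cases h : c = d.castSucc
    · subst h
      simp [jordanBlock, (Fin.castSucc_lt_succ (i := d)).ne]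
    · have h' : ¬ ((c : ℕ) + 1 = (d.succ : ℕ)) := fun h' => h (Fin.ext (by simpa using h'))
      simp only [jordanBlock, of_apply, if_neg h, if_neg h', ite_self, norm_zero]
      norm_num
  simp [h0, hs]

theorem norm_jordanNilpotent_sq (hpos : ∀ i, 0 < k i) :
    ‖jordanNilpotent k hk‖ ^ 2 = (n : ℝ) - p := by
  rw [frobenius_norm_sq, ← Equiv.sum_comp (blockEquiv k hk)]
  calc _ = ∑ x : Σ i, Fin (k i), ∑ y : Σ i, Fin (k i),
        ‖blockDiagonal' (fun i => jordanBlock (k i) 0) x y‖ ^ 2 := by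
        refine Finset.sum_congr rfl fun x _ => ?_
        rw [← Equiv.sum_comp (blockEquiv k hk)]
        exact Finset.sum_congr rfl fun y _ => by
          rw [jordanNilpotent, blockDiag_apply_blockEquiv]
    _ = ∑ i, ∑ c, ∑ d, ‖jordanBlock (k i) 0 c d‖ ^ 2 := by
        rw [Fintype.sum_sigma]
        refine Finset.sum_congr rfl fun i _ => Finset.sum_congr rfl fun c _ => ?_
        rw [Fintype.sum_sigma, Finset.sum_eq_single i]
        · simp only [blockDiagonal'_apply_eq]
        · intro j _ hj
          simp [blockDiagonal'_apply_ne _ _ _ hj.symm]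
        · simp
    _ = (n : ℝ) - p := by
        simp only [fun i => sum_norm_jordanBlock_zero_sq (k i) (hpos i)]
        rw [Finset.sum_sub_distrib, ← Nat.cast_sum, hk]
        simp

theorem norm_jordanNilpotent (hpos : ∀ i, 0 < k i) :
    ‖jordanNilpotent k hk‖ = Real.sqrt ((n : ℝ) - p) := by
  rw [← norm_jordanNilpotent_sq k hk hpos, Real.sqrt_sq (norm_nonneg _)]

/-- The nilpotent part has trace zero, so centring affects `F` only. -/
theorem delta_jordanNilpotent_add_le (hpos : ∀ i, 0 < k i) (F : Matrix (Fin n) (Fin n) ℂ) :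
    delta (jordanNilpotent k hk + F) ≤ Real.sqrt ((n : ℝ) - p) + delta F := by
  rw [delta_eq_norm, delta_eq_norm, trace_add, trace_jordanNilpotent, zero_add, add_sub_assoc,
    ← norm_jordanNilpotent k hk hpos]
  exact norm_add_le _ _

/-- Cauchy–Schwarz over all entries; it bounds the cross term in `delta_scaled_sq_le`. -/
theorem sum_norm_mul_norm_le (M N : Matrix (Fin n) (Fin n) ℂ) :
    ∑ a, ∑ b, ‖M a b‖ * ‖N a b‖ ≤ ‖M‖ * ‖N‖ := by
  have h := Finset.sum_mul_sq_le_sq_mul_sq (Finset.univ : Finset (Fin n × Fin n))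
    (fun x => ‖M x.1 x.2‖) (fun x => ‖N x.1 x.2‖)
  simp only [Fintype.sum_prod_type, ← frobenius_norm_sq, ← mul_pow] at h
  exact le_of_sq_le_sq h (by positivity)

theorem scalingMatrix_eq_diagonal (ε : ℝ) :
    scalingMatrix k hk ε = diagonal fun a => (ε : ℂ) ^ blockPos k hk a :=
  blockDiag_diagonal k hk fun i (j : Fin (k i)) => (ε : ℂ) ^ (j : ℕ)

theorem inv_scalingMatrix {ε : ℝ} (hε : ε ≠ 0) :
    (scalingMatrix k hk ε)⁻¹ = diagonal fun a => ((ε : ℂ) ^ blockPos k hk a)⁻¹ := by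
  refine inv_eq_left_inv ?_
  rw [scalingMatrix_eq_diagonal, diagonal_mul_diagonal, ← diagonal_one]
  congr 1
  funext a
  exact inv_mul_cancel₀ (pow_ne_zero _ (by exact_mod_cast hε))

theorem scaled_apply {ε : ℝ} (hε : ε ≠ 0) (M : Matrix (Fin n) (Fin n) ℂ) (a b : Fin n) :
    ((scalingMatrix k hk ε)⁻¹ * M * scalingMatrix k hk ε) a b
      = ((ε : ℂ) ^ blockPos k hk a)⁻¹ * M a b * (ε : ℂ) ^ blockPos k hk b := by
  rw [inv_scalingMatrix k hk hε, scalingMatrix_eq_diagonal, mul_diagonal, diagonal_mul]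

theorem scaled_diagonal {ε : ℝ} (hε : ε ≠ 0) (d : Fin n → ℂ) :
    (scalingMatrix k hk ε)⁻¹ * diagonal d * scalingMatrix k hk ε = diagonal d := by
  rw [inv_scalingMatrix k hk hε, scalingMatrix_eq_diagonal, diagonal_mul_diagonal,
    diagonal_mul_diagonal]
  congr 1
  funext a
  rw [mul_right_comm, inv_mul_cancel₀ (pow_ne_zero _ (by exact_mod_cast hε)), one_mul]

theorem scaled_jordanNilpotent {ε : ℝ} (hε : ε ≠ 0) :
    (scalingMatrix k hk ε)⁻¹ * jordanNilpotent k hk * scalingMatrix k hk ε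
      = (ε : ℂ) • jordanNilpotent k hk := by
  ext a b
  rw [scaled_apply k hk hε, Matrix.smul_apply, smul_eq_mul]
  by_cases h : jordanNilpotent k hk a b = 0
  · simp [h]
  · rw [blockPos_of_jordanNilpotent_ne_zero k hk h, pow_succ]
    have : (ε : ℂ) ^ blockPos k hk a ≠ 0 := pow_ne_zero _ (by exact_mod_cast hε)
    field_simp

/-- Scaling makes the nilpotent part of order `ε` while blowing the perturbation up by a factor of
at most `ε ^ (1 - m)`; the inner product of the two parts gains a factor `ε ^ 2`. -/
theorem delta_scaled_sq_le (hpos : ∀ i, 0 < k i) {ε : ℝ} (hε : 0 < ε) (hε1 : ε ≤ 1)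
    (F : Matrix (Fin n) (Fin n) ℂ) :
    delta ((scalingMatrix k hk ε)⁻¹ * (jordanNilpotent k hk + F) * scalingMatrix k hk ε) ^ 2
      ≤ ε ^ 2 * ((n : ℝ) - p + 2 * Real.sqrt ((n : ℝ) - p) * delta F)
        + (ε ^ (Finset.univ.sup k - 1))⁻¹ ^ 2 * delta F ^ 2 := by
  set N := jordanNilpotent k hk with hN
  set T := scalingMatrix k hk ε with hT
  set m := Finset.univ.sup k with hm
  set G := F - (F.trace / n) • (1 : Matrix (Fin n) (Fin n) ℂ) with hG
  have hTT : T * T⁻¹ = 1 := by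
    rw [hT, inv_scalingMatrix k hk hε.ne', scalingMatrix_eq_diagonal, diagonal_mul_diagonal,
      ← diagonal_one]
    congr 1
    funext a
    exact mul_inv_cancel₀ (pow_ne_zero _ (by exact_mod_cast hε.ne'))
  have htr : (T⁻¹ * (N + F) * T).trace = F.trace := by
    rw [trace_mul_comm, ← Matrix.mul_assoc, hTT, Matrix.one_mul, trace_add, hN,
      trace_jordanNilpotent, zero_add]
  have hsplit : T⁻¹ * (N + F) * T - (F.trace / n) • (1 : Matrix (Fin n) (Fin n) ℂ)
      = (ε : ℂ) • N + T⁻¹ * G * T := by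
    rw [← scaled_jordanNilpotent k hk hε.ne', hG, Matrix.mul_sub, Matrix.sub_mul, Matrix.mul_smul,
      Matrix.mul_one, Matrix.smul_mul, mul_eq_one_comm.1 hTT, Matrix.mul_add, Matrix.add_mul,
      add_sub_assoc]
  rw [delta_eq_norm, htr, hsplit, frobenius_norm_sq]
  set R := (ε ^ (m - 1))⁻¹ with hR
  have hRone : 1 ≤ R := (one_le_inv₀ (pow_pos hε _)).2 (pow_le_one₀ hε.le hε1)
  have hentry : ∀ a b, ‖((ε : ℂ) • N + T⁻¹ * G * T) a b‖ ^ 2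
      ≤ ε ^ 2 * ‖N a b‖ ^ 2 + 2 * ε ^ 2 * (‖N a b‖ * ‖G a b‖) + R ^ 2 * ‖G a b‖ ^ 2 := by
    intro a b
    rw [Matrix.add_apply, Matrix.smul_apply, smul_eq_mul, hT, scaled_apply k hk hε.ne']
    by_cases h : N a b = 0
    -- Off the support of `N` only `G` contributes, multiplied by a ratio of powers of `ε` that is
    -- at most `R`.
    · rw [h, mul_zero, zero_add, norm_zero, zero_mul, mul_zero, zero_pow two_ne_zero, mul_zero,
        zero_add, zero_add, norm_mul, norm_mul, norm_inv, norm_pow, norm_pow, Complex.norm_real,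
        Real.norm_of_nonneg hε.le, ← mul_pow]
      refine pow_le_pow_left₀ (by positivity) ?_ 2
      have h1 : (ε ^ blockPos k hk a)⁻¹ ≤ R := by
        refine inv_anti₀ (pow_pos hε _) (pow_le_pow_of_le_one hε.le hε1 ?_)
        have := blockPos_lt k hk a
        omega
      calc _ ≤ R * ‖G a b‖ * 1 := by
            gcongr
            exact pow_le_one₀ hε.le hε1
        _ = _ := mul_one _
    -- On the support of `N` the position rises by one, so both parts are multiplied by exactly `ε`.
    · have hz : (ε : ℂ) ^ blockPos k hk a ≠ 0 := pow_ne_zero _ (by exact_mod_cast hε.ne')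
      rw [blockPos_of_jordanNilpotent_ne_zero k hk h,
        show (ε : ℂ) * N a b + ((ε : ℂ) ^ blockPos k hk a)⁻¹ * G a b
          * (ε : ℂ) ^ (blockPos k hk a + 1) = ε * (N a b + G a b) by
            rw [pow_succ]; field_simp, norm_mul, Complex.norm_real,
        Real.norm_of_nonneg hε.le, mul_pow]
      have h2 : ‖N a b + G a b‖ ^ 2 ≤ (‖N a b‖ + ‖G a b‖) ^ 2 :=
        pow_le_pow_left₀ (norm_nonneg _) (norm_add_le _ _) 2
      have h3 : ε ^ 2 * ‖G a b‖ ^ 2 ≤ R ^ 2 * ‖G a b‖ ^ 2 := by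
        gcongr
        exact hε1.trans hRone
      have h4 := mul_le_mul_of_nonneg_left h2 (sq_nonneg ε)
      linarith
  have hcs := sum_norm_mul_norm_le N G
  rw [hN, norm_jordanNilpotent k hk hpos, ← hN] at hcs
  have hδ : delta F = ‖G‖ := delta_eq_norm F
  have hNN := norm_jordanNilpotent_sq k hk hpos
  rw [← hN, frobenius_norm_sq] at hNN
  calc _ ≤ ∑ a, ∑ b, (ε ^ 2 * ‖N a b‖ ^ 2 + 2 * ε ^ 2 * (‖N a b‖ * ‖G a b‖)
        + R ^ 2 * ‖G a b‖ ^ 2) :=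
        Finset.sum_le_sum fun a _ => Finset.sum_le_sum fun b _ => hentry a b
    _ = ε ^ 2 * ((n : ℝ) - p) + 2 * ε ^ 2 * ∑ a, ∑ b, ‖N a b‖ * ‖G a b‖
        + R ^ 2 * delta F ^ 2 := by
        rw [hδ, frobenius_norm_sq, ← hNN]
        simp only [Finset.sum_add_distrib, Finset.mul_sum]
    _ ≤ ε ^ 2 * ((n : ℝ) - p) + 2 * ε ^ 2 * (Real.sqrt ((n : ℝ) - p) * delta F)
        + R ^ 2 * delta F ^ 2 := by
        rw [hδ]
        gcongr
    _ = _ := by ring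

end

/-! ### Spectral distance in terms of `s(M)`, and comparison of the bounds. -/

section

theorem IsSpectrum.conj {n : ℕ} {M P P' : Matrix (Fin n) (Fin n) ℂ} {lam : Fin n → ℂ}
    (h : IsSpectrum M lam) (hP : P * P' = 1) : IsSpectrum (P' * M * P) lam := by
  unfold IsSpectrum at h ⊢
  rwa [charpoly_mul_comm, ← Matrix.mul_assoc, hP, Matrix.one_mul]

/-- Spectral variation of a diagonal-plus-perturbation matrix `M`, in terms of `s(M)`. -/
theorem exists_spectralDist_sq_le {n : ℕ} {d lam lam' : Fin n → ℂ}
    {M F : Matrix (Fin n) (Fin n) ℂ} (hM : M = diagonal d + F)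
    (hlam : Finset.univ.val.map d = Finset.univ.val.map lam) (hlam' : IsSpectrum M lam') :
    ∃ π, spectralDist lam lam' π ^ 2
      ≤ ((n : ℝ) + 1 - maxBlocks M) * delta F ^ 2 + 1 / (n : ℝ) * ‖F.trace‖ ^ 2 := by
  obtain ⟨σ, hσ⟩ := exists_perm_of_map_eq hlam
  have hs := (isGreatest_maxBlocks M).1
  subst hM
  obtain ⟨π, hπ⟩ := exists_perm_sum_sq_le d F hs hlam'
  refine ⟨σ.trans π, ?_⟩
  rw [spectralDist, Real.sq_sqrt (Finset.sum_nonneg fun i _ => sq_nonneg _)]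
  refine le_trans (le_of_eq ?_) hπ
  rw [← Equiv.sum_comp σ fun i => ‖lam' (π i) - d i‖ ^ 2, ← hσ]
  rfl

theorem maxBlocks_le {n : ℕ} (M : Matrix (Fin n) (Fin n) ℂ) : maxBlocks M ≤ n :=
  le_of_mem_blockCounts (isGreatest_maxBlocks M).1

theorem one_le_maxBlocks {n : ℕ} (hn : 0 < n) (M : Matrix (Fin n) (Fin n) ℂ) :
    1 ≤ maxBlocks M := by
  obtain ⟨_, _, k, hk, _⟩ := (isGreatest_maxBlocks M).1
  by_contra! h
  rw [Nat.lt_one_iff] at h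
  have : IsEmpty (Fin (maxBlocks M)) := by rw [h]; infer_instance
  rw [Finset.univ_eq_empty, Finset.sum_empty] at hk
  omega

theorem delta_le_norm {n : ℕ} (F : Matrix (Fin n) (Fin n) ℂ) : delta F ≤ ‖F‖ := by
  refine le_of_sq_le_sq ?_ (norm_nonneg _)
  rw [delta_sq]
  have : 0 ≤ 1 / (n : ℝ) * ‖F.trace‖ ^ 2 := by positivity
  linarith

variable {n p m : ℕ} {c c' : ℝ} {E F : Matrix (Fin n) (Fin n) ℂ}

theorem boundSmall_mono (hp : p ≤ n) (hc : c ≤ c') :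
    boundSmall p m c E F ≤ boundSmall p m c' E F := by
  have : (0 : ℝ) ≤ (n : ℝ) - p := sub_nonneg.2 (by exact_mod_cast hp)
  have := delta_nonneg F
  unfold boundSmall
  gcongr

theorem boundLarge_mono (hc : c ≤ c') : boundLarge p c E F ≤ boundLarge p c' E F := by
  unfold boundLarge
  gcongr

/-- Since `δ²/‖F‖² = 1 - τ/‖F‖²` with `τ = |tr F|²/n`, the added `τ` is absorbed by the saving `c τ
ε²/‖F‖²`, because `c ≥ 1` and `‖F‖ ≤ ε`. -/
theorem boundSmall_le_liChenSmall (hp : p ≤ n) (hm : 0 < m) (hc : 1 ≤ c) (htr : E.trace = F.trace)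
    (hF : 0 < ‖F‖) (hF1 : ‖F‖ < 1) : boundSmall p m c E F ≤ liChenSmall p m c F := by
  have hr : (0 : ℝ) ≤ (n : ℝ) - p := sub_nonneg.2 (by exact_mod_cast hp)
  have hδ := delta_nonneg F
  have hδF := delta_le_norm F
  have hm1 : (1 : ℝ) ≤ m := by exact_mod_cast hm
  have hεF : ‖F‖ ≤ ‖F‖ ^ (1 / (m : ℝ)) := by
    conv_lhs => rw [← Real.rpow_one ‖F‖]
    exact Real.rpow_le_rpow_of_exponent_ge hF hF1.le (div_le_one_of_le₀ hm1 (by positivity))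
  have hε2 : ‖F‖ ^ (2 / (m : ℝ)) = (‖F‖ ^ (1 / (m : ℝ))) ^ 2 := by
    rw [← Real.rpow_mul_natCast hF.le]
    congr 1
    push_cast
    ring
  unfold boundSmall liChenSmall
  rw [hε2, htr]
  set ε := ‖F‖ ^ (1 / (m : ℝ))
  have hε : 0 < ε := Real.rpow_pos_of_pos hF _
  set r := Real.sqrt ((n : ℝ) - p)
  have hr0 : 0 ≤ r := Real.sqrt_nonneg _
  set τ := 1 / (n : ℝ) * ‖F.trace‖ ^ 2 with hτ
  have hτ0 : 0 ≤ τ := by positivity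
  have hτF : delta F ^ 2 / ‖F‖ ^ 2 = 1 - τ / ‖F‖ ^ 2 := by
    rw [delta_sq, ← hτ, sub_div, div_self (pow_pos hF 2).ne']
  have h1 : τ ≤ c * (τ / ‖F‖ ^ 2) * ε ^ 2 := by
    have h2 : 1 ≤ ε ^ 2 / ‖F‖ ^ 2 := (one_le_div (pow_pos hF 2)).2 (pow_le_pow_left₀ hF.le hεF 2)
    calc τ = 1 * τ * 1 := by ring
      _ ≤ c * τ * (ε ^ 2 / ‖F‖ ^ 2) := by gcongr
      _ = _ := by ring
  rw [← Real.sqrt_sq hε.le, ← Real.sqrt_mul (by positivity)]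
  refine Real.sqrt_le_sqrt ?_
  rw [Real.sqrt_sq hε.le, hτF]
  have h3 : c * (2 * r * delta F) * ε ^ 2 ≤ c * (2 * r * ‖F‖) * ε ^ 2 := by gcongr
  linarith

/-- As `c ≥ 1`, the trace term may be multiplied by `c` and then merged with `δ²` into `‖F‖²`; a
factor `‖F‖ ≥ 1` is inserted into the `n - p` term. -/
theorem boundLarge_le_liChenLarge (hp : p ≤ n) (hc : 1 ≤ c) (htr : E.trace = F.trace)
    (hF1 : 1 ≤ ‖F‖) : boundLarge p c E F ≤ liChenLarge p c F := by
  have hr : (0 : ℝ) ≤ (n : ℝ) - p := sub_nonneg.2 (by exact_mod_cast hp)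
  have hδF := delta_le_norm F
  unfold boundLarge liChenLarge
  rw [htr, ← Real.sqrt_eq_rpow, ← Real.sqrt_mul (by positivity)]
  refine Real.sqrt_le_sqrt ?_
  have hsq := Real.sq_sqrt hr
  set r := Real.sqrt ((n : ℝ) - p)
  have hr0 : 0 ≤ r := Real.sqrt_nonneg _
  have hδ2 := delta_sq F
  set τ := 1 / (n : ℝ) * ‖F.trace‖ ^ 2 with hτ
  have hτ0 : 0 ≤ τ := by positivity
  calc c * (r + delta F) ^ 2 + τ
      ≤ c * (r + delta F) ^ 2 + c * τ := by
        gcongr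
        exact le_mul_of_one_le_left hτ0 hc
    _ = c * (((n : ℝ) - p) * 1 + 2 * r * delta F + ‖F‖ * ‖F‖) := by
        rw [← hsq]
        linear_combination c * hδ2
    _ ≤ c * (((n : ℝ) - p) * ‖F‖ + 2 * r * ‖F‖ + ‖F‖ * ‖F‖) := by gcongr
    _ = _ := by ring

end

end SpectrumVariation

/-! ### The main theorem. -/

open SpectrumVariation Matrix

theorem theorem3p4 {n p : ℕ} (A E Q : Matrix (Fin n) (Fin n) ℂ) (hQ : IsUnit Q)
    -- Jordan decomposition of `A`: blocks of orders `k i ≥ 1` with eigenvalues `μ i`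
    (k : Fin p → ℕ) (hk : ∑ i, k i = n) (hpos : ∀ i, 0 < k i) (μ : Fin p → ℂ)
    (hJ : Q⁻¹ * A * Q
      = SpectrumVariation.blockDiag k hk fun i => SpectrumVariation.jordanBlock (k i) (μ i))
    (m : ℕ) (hm : m = Finset.univ.sup k)
    (EQ : Matrix (Fin n) (Fin n) ℂ) (hEQ : EQ = Q⁻¹ * E * Q)
    (T : Matrix (Fin n) (Fin n) ℂ)
    (hT : T = SpectrumVariation.scalingMatrix k hk (‖EQ‖ ^ (1 / (m : ℝ))))
    (s₁ s₂ : ℝ)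
    (hs₁ : s₁ = (n : ℝ) + 1 - SpectrumVariation.maxBlocks (T⁻¹ * Q⁻¹ * (A + E) * Q * T))
    (hs₂ : s₂ = (n : ℝ) + 1 - SpectrumVariation.maxBlocks (Q⁻¹ * (A + E) * Q))
    (lam lam' : Fin n → ℂ) (hlam : SpectrumVariation.IsSpectrum A lam)
    (hlam' : SpectrumVariation.IsSpectrum (A + E) lam') :
    -- the estimate; for `E = 0`, where `T` is not defined, the distance is zero
    (∃ π : Equiv.Perm (Fin n),
      (E = 0 → SpectrumVariation.spectralDist lam lam' π = 0) ∧
      (0 < ‖EQ‖ → ‖EQ‖ < 1 →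
        SpectrumVariation.spectralDist lam lam' π ≤ SpectrumVariation.boundSmall p m s₁ E EQ) ∧
      (1 ≤ ‖EQ‖ →
        SpectrumVariation.spectralDist lam lam' π ≤ SpectrumVariation.boundLarge p s₂ E EQ)) ∧
    -- it refines the same estimate with factor `n`, and the Li–Chen estimate
    (0 < ‖EQ‖ → ‖EQ‖ < 1 →
      SpectrumVariation.boundSmall p m s₁ E EQ ≤ SpectrumVariation.boundSmall p m n E EQ ∧
      SpectrumVariation.boundSmall p m s₁ E EQ ≤ SpectrumVariation.liChenSmall p m s₁ EQ) ∧
    (1 ≤ ‖EQ‖ →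
      SpectrumVariation.boundLarge p s₂ E EQ ≤ SpectrumVariation.boundLarge p n E EQ ∧
      SpectrumVariation.boundLarge p s₂ E EQ ≤ SpectrumVariation.liChenLarge p s₂ EQ) := by
  have hQd : IsUnit Q.det := (isUnit_iff_isUnit_det Q).1 hQ
  have hQQ : Q * Q⁻¹ = 1 := mul_nonsing_inv Q hQd
  have htr : E.trace = EQ.trace := by
    rw [hEQ, trace_mul_comm, ← Matrix.mul_assoc, hQQ, Matrix.one_mul]
  have hpn : p ≤ n := by
    calc p = ∑ _i : Fin p, 1 := by simp
      _ ≤ ∑ i, k i := Finset.sum_le_sum fun i _ => hpos i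
      _ = n := hk
  set d := jordanDiag k hk μ with hd
  set N := jordanNilpotent k hk with hN
  have hdecomp : Q⁻¹ * (A + E) * Q = diagonal d + (N + EQ) := by
    rw [Matrix.mul_add, Matrix.add_mul, hJ, ← hEQ, blockDiag_jordanBlock, add_assoc]
  have hdlam : Finset.univ.val.map d = Finset.univ.val.map lam := by
    have h := hlam.conj hQQ
    rw [hJ, IsSpectrum, roots_charpoly_of_isUpperTriangular
      (blockDiag_jordanBlock_isUpperTriangular k hk μ)] at h
    simpa only [diagonal_jordanDiag_apply] using h
  have hspecQ := hlam'.conj hQQ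
  have htrN : (N + EQ).trace = E.trace := by
    rw [trace_add, hN, trace_jordanNilpotent, zero_add, htr]
  have hn_of : 0 < ‖EQ‖ → 0 < n := fun h => Nat.pos_of_ne_zero fun h0 => by
    subst h0
    rw [Subsingleton.elim EQ 0, norm_zero] at h
    exact lt_irrefl _ h
  -- The lower bound gives nonnegativity and the Li–Chen comparison, the upper one the comparison
  -- with factor `n`.
  have hs_mem : 0 < n → ∀ M : Matrix (Fin n) (Fin n) ℂ,
      1 ≤ (n : ℝ) + 1 - maxBlocks M ∧ (n : ℝ) + 1 - maxBlocks M ≤ n := fun hn M => by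
    have h1 : ((maxBlocks M : ℕ) : ℝ) ≤ n := by exact_mod_cast maxBlocks_le M
    have h2 : (1 : ℝ) ≤ maxBlocks M := by exact_mod_cast one_le_maxBlocks hn M
    constructor <;> linarith
  have hm_pos : 0 < n → 0 < m := fun hn =>
    hm ▸ (Nat.zero_le _).trans_lt (blockPos_lt k hk ⟨0, hn⟩)
  refine ⟨?_, fun h0 h1 => ?_, fun h1 => ?_⟩
  · by_cases hE : E = 0
    · subst hE
      have hEQ0 : ‖EQ‖ = 0 := by rw [hEQ]; simp
      rw [add_zero] at hlam'
      obtain ⟨π, hπ⟩ := exists_perm_of_map_eq (f := lam') (g := lam) (hlam'.symm.trans hlam)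
      refine ⟨π, fun _ => ?_, fun h => absurd h (by rw [hEQ0]; exact lt_irrefl _),
        fun h => absurd h (by rw [hEQ0]; norm_num)⟩
      rw [← hπ]
      simp [spectralDist]
    · by_cases hlt : ‖EQ‖ < 1
      · by_cases h0 : 0 < ‖EQ‖
        · have hn := hn_of h0
          have hm0 := hm_pos hn
          have hm0' : (m : ℝ) ≠ 0 := by exact_mod_cast hm0.ne'
          set ε := ‖EQ‖ ^ (1 / (m : ℝ)) with hεdef
          have hε : 0 < ε := Real.rpow_pos_of_pos h0 _
          have hε1 : ε ≤ 1 := Real.rpow_le_one h0.le hlt.le (by positivity)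
          have hεm : ε ^ m = ‖EQ‖ := by
            rw [hεdef, ← Real.rpow_mul_natCast h0.le, one_div_mul_cancel hm0', Real.rpow_one]
          have hε2 : ‖EQ‖ ^ (2 / (m : ℝ)) = ε ^ 2 := by
            rw [hεdef, ← Real.rpow_mul_natCast h0.le]
            congr 1
            push_cast
            ring
          -- Since `ε^m = ‖E_Q‖`, the growth factor is `ε/‖E_Q‖`, which produces the term
          -- `δ²/‖E_Q‖²` times `ε²`.
          have hR : (ε ^ (m - 1))⁻¹ = ε / ‖EQ‖ := by
            rw [← hεm, ← pow_sub_one_mul hm0.ne' ε]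
            field_simp
          have hTT : T * T⁻¹ = 1 := by
            refine mul_nonsing_inv T ?_
            rw [hT, scalingMatrix_eq_diagonal, det_diagonal, isUnit_iff_ne_zero]
            exact Finset.prod_ne_zero_iff.2 fun a _ => pow_ne_zero _ (by exact_mod_cast hε.ne')
          have hassoc : T⁻¹ * Q⁻¹ * (A + E) * Q * T = T⁻¹ * (Q⁻¹ * (A + E) * Q) * T := by
            simp only [Matrix.mul_assoc]
          have hM : T⁻¹ * Q⁻¹ * (A + E) * Q * T = diagonal d + T⁻¹ * (N + EQ) * T := by
            rw [hassoc, hdecomp, Matrix.mul_add, Matrix.add_mul, hT, scaled_diagonal k hk hε.ne']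
          have hspecT : IsSpectrum (T⁻¹ * Q⁻¹ * (A + E) * Q * T) lam' := by
            rw [hassoc]
            exact hspecQ.conj hTT
          obtain ⟨π, hπ⟩ := exists_spectralDist_sq_le hM hdlam hspecT
          refine ⟨π, fun h => absurd h hE, fun _ _ => ?_, fun h => absurd hlt (not_lt.2 h)⟩
          refine Real.le_sqrt_of_sq_le (hπ.trans ?_)
          have htrT : (T⁻¹ * (N + EQ) * T).trace = E.trace := by
            rw [trace_mul_comm, ← Matrix.mul_assoc, hTT, Matrix.one_mul, htrN]
          have hδ := delta_scaled_sq_le k hk hpos hε hε1 EQ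
          rw [← hT, ← hN, ← hm, hR] at hδ
          rw [htrT, ← hs₁, hε2]
          have hs := (hs_mem hn (T⁻¹ * Q⁻¹ * (A + E) * Q * T)).1
          rw [← hs₁] at hs
          have h3 := mul_le_mul_of_nonneg_left hδ (zero_le_one.trans hs)
          refine add_le_add (h3.trans (le_of_eq ?_)) le_rfl
          ring
        -- Invertibility of `Q` excludes this case, but all three claims are vacuous here, so any
        -- permutation serves.
        · exact ⟨1, fun h => absurd h hE, fun h => absurd h h0, fun h => absurd hlt (not_lt.2 h)⟩
      · obtain ⟨π, hπ⟩ := exists_spectralDist_sq_le hdecomp hdlam hspecQ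
        refine ⟨π, fun h => absurd h hE, fun _ h => absurd h hlt, fun h1 => ?_⟩
        refine Real.le_sqrt_of_sq_le (hπ.trans ?_)
        have hs := (hs_mem (hn_of (zero_lt_one.trans_le h1)) (Q⁻¹ * (A + E) * Q)).1
        rw [htrN, ← hs₂]
        rw [← hs₂] at hs
        have hδ := delta_jordanNilpotent_add_le k hk hpos EQ
        have hδ0 := delta_nonneg (N + EQ)
        gcongr
  · have hn := hn_of h0
    have hs := hs_mem hn (T⁻¹ * Q⁻¹ * (A + E) * Q * T)
    rw [← hs₁] at hs
    exact ⟨boundSmall_mono hpn hs.2, boundSmall_le_liChenSmall hpn (hm_pos hn) hs.1 htr h0 h1⟩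
  · have hs := hs_mem (hn_of (zero_lt_one.trans_le h1)) (Q⁻¹ * (A + E) * Q)
    rw [← hs₂] at hs
    exact ⟨boundLarge_mono hs.2, boundLarge_le_liChenLarge hpn hs.1 htr h1⟩
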